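/- Let $R$ be a commutative noetherian ring, $\mathfrak a$ an ideal of $R$, and $D(R)$ the (unbounded) derived category of $R$-modules. For an $R$-module $M$ let $\Gamma_{\mathfrak a}(M)=\{m\in M : \mathfrak a^n m=0 \text{ for some } n\ge 0\}$. For $X\in D(R)$ write $H_i(X)=H^{-i}(X)$, $\sup X=\sup\{i : H_i(X)\neq 0\}$ and $\inf X=\inf\{i : H_i(X)\ne 0\}$ (so $\sup X=-\infty$ and $\inf X=+\infty$ if $X$ is acyclic). A functor $F:D(R)\to D(R)$ is way-out if for every $n\in\mathbb Z$ there is $m\in\mathbb Z$ such that $\sup X\le m$ implies $\sup F(X)\le n$ for all $X\in D(R)$, and for every $n\in\mathbb Z$ there is $m\in\mathbb Z$ such that $\inf X\ge m$ implies $\inf F(X)\ge n$ for all $X\in D(R)$. An $R$-module $M$ is $\mathfrak a$-cofinite if $\operatorname{Supp}_R(M)\subseteq V(\mathfrak a)$ and $\operatorname{Ext}^i_R(R/\mathfrak a,M)$ is finitely generated for every $i\ge 0$. Theorem 3.3. The total right derived functor $\mathbf R\Gamma_{\mathfrak a}:D(R)\to D(R)$ of $\Gamma_{\mathfrak a}$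 exists, and it is triangulated (with respect to the commutation with shifts compatible with the canonical transformation from $\Gamma_{\mathfrak a}$ to $\mathbf R\Gamma_{\mathfrak a}$) and way-out. Put $H^i_{\mathfrak a}(X)=H_{-i}(\mathbf R\Gamma_{\mathfrak a}(X))$ for $X\in D(R)$ and $i\in\mathbb Z$, where an $R$-module is regarded as a complex concentrated in degree $0$. If $H^i_{\mathfrak a}(M)$ is $\mathfrak a$-cofinite for every finitely generated $R$-module $M$ and every $i\ge 0$, and the full subcategory of $\mathfrak a$-cofinite $R$-modules is an abelian category, then $H^i_{\mathfrak a}(X)$ is $\mathfrak a$-cofinite for every $X\in D(R)$ all of whose homology modules are finitely generated and every $i\in\mathbb Z$. -/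

import Mathlib

open CategoryTheory

universe w w' u u'

namespace WayOutCofinite

noncomputable section

section Torsion

variable {R : Type u} [CommRing R] (𝔞 : Ideal R)

/-- The submodule `Γ_𝔞(M) = {m ∈ M | 𝔞 ^ n m = 0 for some n}` of `𝔞`-torsion elements of `M`. -/
def gammaSubmodule (M : Type u') [AddCommGroup M] [Module R M] : Submodule R M where
  carrier := {m | ∃ n : ℕ, ∀ r ∈ 𝔞 ^ n, r • m = 0}
  zero_mem' := ⟨0, fun r _ => smul_zero r⟩
  add_mem' := by
    rintro x y ⟨n, hn⟩ ⟨k, hk⟩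
    refine ⟨n + k, fun r hr => ?_⟩
    rw [smul_add, hn r (Ideal.pow_le_pow_right (Nat.le_add_right n k) hr),
      hk r (Ideal.pow_le_pow_right (Nat.le_add_left k n) hr), add_zero]
  smul_mem' := by
    rintro c x ⟨n, hn⟩
    exact ⟨n, fun r hr => by rw [smul_comm, hn r hr, smul_zero]⟩

theorem gammaSubmodule_map {M N : Type u'} [AddCommGroup M] [Module R M] [AddCommGroup N]
    [Module R N] (f : M →ₗ[R] N) (x : M) (hx : x ∈ gammaSubmodule 𝔞 M) :
    f x ∈ gammaSubmodule 𝔞 N := by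
  obtain ⟨n, hn⟩ := hx
  exact ⟨n, fun r hr => by rw [← map_smul, hn r hr, map_zero]⟩

/-- The `𝔞`-torsion functor `Γ_𝔞` on the category of `R`-modules. -/
def gammaFunctor : ModuleCat.{u} R ⥤ ModuleCat.{u} R where
  obj M := ModuleCat.of R (gammaSubmodule 𝔞 M)
  map f := ModuleCat.ofHom (f.hom.restrict (gammaSubmodule_map 𝔞 f.hom))

instance : (gammaFunctor 𝔞).Additive where

variable [HasDerivedCategory.{w} (ModuleCat.{u} R)]

/-- The functor `K(R) ⥤ D(R)` which applies `Γ_𝔞` degreewise to a complex. -/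
abbrev gammaHomotopy :
    HomotopyCategory (ModuleCat.{u} R) (ComplexShape.up ℤ) ⥤ DerivedCategory (ModuleCat.{u} R) :=
  (gammaFunctor 𝔞).mapHomotopyCategory (ComplexShape.up ℤ) ⋙ DerivedCategory.Qh

/-- `(RΓ, α)` is the total right derived functor `D(R) ⥤ D(R)` of `Γ_𝔞` on unbounded
complexes: `α` is universal among the natural transformations from `Γ_𝔞` (as a functor on `K(R)`)
to functors that factor through `D(R)`. -/
abbrev IsRGamma (RΓ : DerivedCategory (ModuleCat.{u} R) ⥤ DerivedCategory (ModuleCat.{u} R))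
    (α : gammaHomotopy 𝔞 ⟶ DerivedCategory.Qh ⋙ RΓ) : Prop :=
  RΓ.IsRightDerivedFunctor α (HomotopyCategory.quasiIso (ModuleCat.{u} R) (ComplexShape.up ℤ))

end Torsion

section Homology

variable {R : Type u} [CommRing R] [HasDerivedCategory.{w} (ModuleCat.{u} R)]

/-- The homology module `H_i(X) = H^{-i}(X)`, in homological grading. -/
def homologyModule (X : DerivedCategory (ModuleCat.{u} R)) (i : ℤ) : ModuleCat.{u} R :=
  (DerivedCategory.homologyFunctor (ModuleCat.{u} R) (-i)).obj X

/-- `sup X = sup {i | H_i(X) ≠ 0}`, which is `-∞` if `X` is acyclic. -/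
def homologySup (X : DerivedCategory (ModuleCat.{u} R)) : EReal :=
  sSup {x | ∃ i : ℤ, ¬ Limits.IsZero (homologyModule X i) ∧ x = ((i : ℝ) : EReal)}

/-- `inf X = inf {i | H_i(X) ≠ 0}`, which is `+∞` if `X` is acyclic. -/
def homologyInf (X : DerivedCategory (ModuleCat.{u} R)) : EReal :=
  sInf {x | ∃ i : ℤ, ¬ Limits.IsZero (homologyModule X i) ∧ x = ((i : ℝ) : EReal)}

variable {S : Type u'} [CommRing S] [HasDerivedCategory.{w'} (ModuleCat.{u'} S)]
  (F : DerivedCategory (ModuleCat.{u} R) ⥤ DerivedCategory (ModuleCat.{u'} S))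

def IsWayOutLeft : Prop :=
  ∀ n : ℤ, ∃ m : ℤ, ∀ X : DerivedCategory (ModuleCat.{u} R),
    homologySup X ≤ ((m : ℝ) : EReal) → homologySup (F.obj X) ≤ ((n : ℝ) : EReal)

def IsWayOutRight : Prop :=
  ∀ n : ℤ, ∃ m : ℤ, ∀ X : DerivedCategory (ModuleCat.{u} R),
    ((m : ℝ) : EReal) ≤ homologyInf X → ((n : ℝ) : EReal) ≤ homologyInf (F.obj X)

def IsWayOut : Prop := IsWayOutLeft F ∧ IsWayOutRight F

/-- `X ∈ D^f(R)`: all homology modules of `X` are finitely generated. -/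
def HasFiniteHomology (X : DerivedCategory (ModuleCat.{u} R)) : Prop :=
  ∀ i : ℤ, Module.Finite R (homologyModule X i)

/-- `H^i_𝔞(X) = H_{-i}(RΓ_𝔞(X))`, where `RΓ` is the derived torsion functor. -/
def localCohomologyModule
    (RΓ : DerivedCategory (ModuleCat.{u} R) ⥤ DerivedCategory (ModuleCat.{u} R)) (i : ℤ)
    (X : DerivedCategory (ModuleCat.{u} R)) : ModuleCat.{u} R :=
  homologyModule (RΓ.obj X) (-i)

end Homology

/-- The `𝔞`-cofinite modules: `Supp M ⊆ V(𝔞)` and `Ext^i(R/𝔞, M)` is finitely generated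
for all `i ≥ 0`. -/
def cofinite {R : Type u} [CommRing R] (𝔞 : Ideal R) : ObjectProperty (ModuleCat.{u} R) :=
  fun M => Module.support R M ⊆ PrimeSpectrum.zeroLocus (𝔞 : Set R) ∧
    ∀ i : ℕ, Module.Finite R (Abelian.Ext (ModuleCat.of R (R ⧸ 𝔞)) M i)

end

end WayOutCofinite

/-!
The derived functor is computed by K-injective resolutions. A complex `X` of modules, possibly
unbounded, has such a resolution by injective modules: resolve the truncations `τ_{≥ -n} X` by
bounded below complexes of injectives and take the homotopy limit of these resolutions
(`exists_resolution`). As products of modules are exact and the homology of the tower is eventually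
constant in each degree, the homotopy limit is again `X`. Hence `K(R) ⥤ D(R)` has a right adjoint
`ρ`, and `ρ` followed by `Γ_𝔞` is the derived functor, since precomposition with a right adjoint is
a left Kan extension. Right adjoints of triangulated functors are triangulated, and any other
derived functor is isomorphic to this one compatibly with the canonical transformations
(`isTriangulated_of_isRGamma`).

The functor `RΓ_𝔞` preserves lower bounds of cohomology because bounded below complexes have
resolutions with the same bound. It raises upper bounds by at most the number of generators of `𝔞`:
a complex of injectives which is exact in high degrees stays exact, one degree further up, after
applying `Γ_x` for a single element `x`, and over a noetherian ring `Γ_𝔟` preserves injectives by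
the Artin-Rees lemma, so that one can iterate (`exact_gammaSubmodule_of_injective`).

For cofiniteness, the only consequence needed of the cofinite modules forming an abelian category
is that they are closed under kernels of linear maps (`cofinite_ker`). With the long exact sequence
of `Ext` this shows that the middle term of a five-term exact sequence is cofinite if the other
four are (`cofinite_of_exact`). Complexes with bounded, finitely generated homology are then treated
by induction on the length, through truncation triangles, starting from modules; and as `RΓ_𝔞` is
way-out, `H^i_𝔞(X)` only depends on a bounded piece of `X`
(`cofinite_homology`).
-/

namespace WayOutCofinite

/-! ### The torsion functor on injective modules -/

section InjectiveTorsion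

variable {R : Type u} [CommRing R]

theorem gammaSubmodule_bot (M : Type u') [AddCommGroup M] [Module R M] :
    gammaSubmodule (⊥ : Ideal R) M = ⊤ := by
  refine eq_top_iff.2 fun x _ => ⟨1, fun r hr => ?_⟩
  rw [pow_one, Ideal.mem_bot] at hr
  rw [hr, zero_smul]

theorem gammaSubmodule_anti {𝔞 𝔟 : Ideal R} (h : 𝔞 ≤ 𝔟) (M : Type u') [AddCommGroup M]
    [Module R M] : gammaSubmodule 𝔟 M ≤ gammaSubmodule 𝔞 M :=
  fun _ ⟨n, hn⟩ => ⟨n, fun r hr => hn r (Ideal.pow_right_mono h n hr)⟩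

theorem mem_gammaSubmodule_span_singleton {M : Type u'} [AddCommGroup M] [Module R M] {x : R}
    {m : M} : m ∈ gammaSubmodule (Ideal.span {x}) M ↔ ∃ n : ℕ, x ^ n • m = 0 := by
  constructor
  · rintro ⟨n, hn⟩
    exact ⟨n, hn _ (Ideal.pow_mem_pow (Ideal.mem_span_singleton_self x) n)⟩
  · rintro ⟨n, hn⟩
    refine ⟨n, fun r hr => ?_⟩
    rw [Ideal.span_singleton_pow, Ideal.mem_span_singleton'] at hr
    obtain ⟨c, rfl⟩ := hr
    rw [mul_smul, hn, smul_zero]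

theorem mem_gammaSubmodule_sup {M : Type u'} [AddCommGroup M] [Module R M] {𝔞 𝔟 : Ideal R}
    {m : M} (h₁ : m ∈ gammaSubmodule 𝔞 M) (h₂ : m ∈ gammaSubmodule 𝔟 M) :
    m ∈ gammaSubmodule (𝔞 ⊔ 𝔟) M := by
  obtain ⟨k, hk⟩ := h₁
  obtain ⟨l, hl⟩ := h₂
  refine ⟨k + l, fun r hr => ?_⟩
  obtain ⟨y, hy, z, hz, rfl⟩ := Submodule.mem_sup.1 (Ideal.sup_pow_add_le_pow_sup_pow hr)
  rw [add_smul, hk y hy, hl z hz, add_zero]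

/-- A finitely generated submodule of `Γ_𝔞(M)` is annihilated by a single power of `𝔞`. -/
theorem exists_pow_smul_eq_zero_of_fg {M : Type u'} [AddCommGroup M] [Module R M] {𝔞 : Ideal R}
    {N : Submodule R M} (hN : N.FG) (h : N ≤ gammaSubmodule 𝔞 M) :
    ∃ n : ℕ, ∀ r ∈ 𝔞 ^ n, ∀ x ∈ N, r • x = 0 := by
  induction N, hN using Submodule.fg_induction with
  | singleton x =>
    obtain ⟨n, hn⟩ := h (Submodule.mem_span_singleton_self x)
    refine ⟨n, fun r hr y hy => ?_⟩
    obtain ⟨c, rfl⟩ := Submodule.mem_span_singleton.1 hy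
    rw [smul_comm, hn r hr, smul_zero]
  | sup N₁ N₂ _ _ h₁ h₂ =>
    obtain ⟨k, hk⟩ := h₁ (le_sup_left.trans h)
    obtain ⟨l, hl⟩ := h₂ (le_sup_right.trans h)
    refine ⟨k + l, fun r hr x hx => ?_⟩
    obtain ⟨y, hy, z, hz, rfl⟩ := Submodule.mem_sup.1 hx
    rw [smul_add, hk r (Ideal.pow_le_pow_right (Nat.le_add_right k l) hr) y hy,
      hl r (Ideal.pow_le_pow_right (Nat.le_add_left l k) hr) z hz, add_zero]

/-- Over a noetherian ring `Γ_𝔞` preserves injectivity. By the Artin-Rees lemma, a map from an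
ideal `I` to `Γ_𝔞(J)` kills `I ∩ 𝔞 ^ m` for some `m`, so it extends by zero to `I + 𝔞 ^ m`; an
extension of the latter to `R` has its values in `Γ_𝔞(J)`. -/
theorem baer_gammaSubmodule [IsNoetherianRing R] (𝔞 : Ideal R) {J : Type u'} [AddCommGroup J]
    [Module R J] (hJ : Module.Baer R J) : Module.Baer R (gammaSubmodule 𝔞 J) := by
  intro I g
  set g' : I →ₗ[R] J := (gammaSubmodule 𝔞 J).subtype ∘ₗ g with hg'
  have hfg : (LinearMap.range g').FG :=
    (Module.Finite.iff_fg (N := LinearMap.range g')).1 inferInstance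
  obtain ⟨n, hn⟩ := exists_pow_smul_eq_zero_of_fg (𝔞 := 𝔞) hfg (by
    rintro _ ⟨x, rfl⟩
    exact (g x).2)
  obtain ⟨k, hk⟩ := Ideal.exists_pow_inf_eq_pow_smul (M := R) 𝔞 I
  have hzero : ∀ x (hx : x ∈ I), x ∈ 𝔞 ^ (n + k) → g' ⟨x, hx⟩ = 0 := by
    intro x hx hx'
    have h1 : x ∈ 𝔞 ^ n • I := by
      have h2 : x ∈ 𝔞 ^ (n + k) • (⊤ : Ideal R) ⊓ I := ⟨by simpa using hx', hx⟩
      rw [hk (n + k) (Nat.le_add_left k n), Nat.add_sub_cancel] at h2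
      exact Submodule.smul_mono le_rfl inf_le_right h2
    obtain ⟨_, h2⟩ : ∃ hx : x ∈ I, g' ⟨x, hx⟩ = 0 := by
      refine Submodule.smul_induction_on h1 ?_ ?_
      · intro r hr y hy
        refine ⟨I.smul_mem r hy, ?_⟩
        have h3 : (⟨r • y, I.smul_mem r hy⟩ : I) = r • ⟨y, hy⟩ := rfl
        rw [h3, map_smul]
        exact hn r hr _ ⟨_, rfl⟩
      · rintro y z ⟨hy, hy'⟩ ⟨hz, hz'⟩
        refine ⟨I.add_mem hy hz, ?_⟩
        have h3 : (⟨y + z, I.add_mem hy hz⟩ : I) = ⟨y, hy⟩ + ⟨z, hz⟩ := rfl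
        rw [h3, map_add, hy', hz', add_zero]
    exact h2
  let p : R →ₗ.[R] J := ⟨I, g'⟩
  let q : R →ₗ.[R] J := ⟨𝔞 ^ (n + k), 0⟩
  have hpq : ∀ (x : p.domain) (y : q.domain), (x : R) = y → p x = q y := by
    rintro ⟨x, hx⟩ ⟨y, hy⟩ rfl
    exact hzero x hx hy
  obtain ⟨l, hl⟩ := hJ (I ⊔ 𝔞 ^ (n + k)) (p.sup q hpq).toFun
  have hlI : ∀ x (hx : x ∈ I), l x = g' ⟨x, hx⟩ := by
    intro x hx
    rw [hl x (Submodule.mem_sup_left hx)]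
    refine (LinearPMap.sup_apply hpq ⟨x, hx⟩ ⟨0, zero_mem _⟩ ⟨x, _⟩ (add_zero x)).trans ?_
    exact add_zero _
  have hla : ∀ x ∈ 𝔞 ^ (n + k), l x = 0 := by
    intro x hx
    rw [hl x (Submodule.mem_sup_right hx)]
    refine (LinearPMap.sup_apply hpq ⟨0, zero_mem _⟩ ⟨x, hx⟩ ⟨x, _⟩ (zero_add x)).trans ?_
    exact (add_zero _).trans (map_zero g')
  refine ⟨l.codRestrict _ fun x => ⟨n + k, fun r hr => ?_⟩, fun x hx => Subtype.ext (hlI x hx)⟩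
  rw [← map_smul]
  exact hla _ (Ideal.mul_mem_right _ _ hr)

/-- Up to `x`-power torsion, an element `w` of an injective module over a noetherian ring is
divisible by every power of `x`: the localization map `J → J_x` is surjective. -/
theorem exists_pow_smul_sub_mem_torsion [IsNoetherianRing R] {J : Type u'} [AddCommGroup J]
    [Module R J] (hJ : Module.Baer R J) (x : R) (n : ℕ) (w : J) :
    ∃ (w' : J) (k : ℕ), x ^ k • (w - x ^ n • w') = 0 := by
  -- the annihilators of the powers of `x` form an increasing, hence eventually constant, sequence
  let f : ℕ →o Ideal R :=
    { toFun := fun k => LinearMap.ker (LinearMap.mulLeft R (x ^ k))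
      monotone' := by
        intro a b hab r hr
        rw [LinearMap.mem_ker, LinearMap.mulLeft_apply] at hr ⊢
        rw [← Nat.sub_add_cancel hab, pow_add, mul_assoc, hr, mul_zero] }
  obtain ⟨k, hk⟩ := monotone_stabilizes_iff_noetherian.2 (inferInstance : IsNoetherian R R) f
  let m : R →ₗ[R] R := LinearMap.mulLeft R (x ^ (k + n))
  let t : R →ₗ[R] J := LinearMap.toSpanSingleton R J (x ^ k • w)
  have hmt : LinearMap.ker m ≤ LinearMap.ker t := by
    intro r hr
    have h1 : r ∈ f k := by
      rw [hk (k + n) (Nat.le_add_right k n)]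
      exact hr
    have h2 : x ^ k * r = 0 := h1
    rw [LinearMap.mem_ker, LinearMap.toSpanSingleton_apply, smul_smul, mul_comm, h2, zero_smul]
  let g : LinearMap.range m →ₗ[R] J :=
    (LinearMap.ker m).liftQ t hmt ∘ₗ m.quotKerEquivRange.symm.toLinearMap
  obtain ⟨l, hl⟩ := hJ (LinearMap.range m) g
  have hx : x ^ (k + n) ∈ LinearMap.range m := ⟨1, mul_one _⟩
  have h1 : l (x ^ (k + n)) = x ^ k • w := by
    rw [hl _ hx]
    have h2 : m.quotKerEquivRange.symm ⟨x ^ (k + n), hx⟩ = (LinearMap.ker m).mkQ 1 := by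
      rw [LinearEquiv.symm_apply_eq]
      exact Subtype.ext (mul_one _).symm
    change (LinearMap.ker m).liftQ t hmt (m.quotKerEquivRange.symm ⟨x ^ (k + n), hx⟩) = _
    rw [h2]
    change t 1 = _
    exact one_smul R _
  refine ⟨l 1, k, ?_⟩
  rw [smul_sub, smul_smul, ← pow_add, ← map_smul, smul_eq_mul, mul_one, h1, sub_self]

/-- `Γ_x` of an exact sequence `A → B → C → D` is exact at `C` as soon as `A` is injective. -/
theorem exact_gammaSubmodule_span_singleton [IsNoetherianRing R] (x : R)
    {A B C D : Type u'} [AddCommGroup A] [AddCommGroup B] [AddCommGroup C] [AddCommGroup D]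
    [Module R A] [Module R B] [Module R C] [Module R D] (hA : Module.Baer R A)
    (f : A →ₗ[R] B) (g : B →ₗ[R] C) (h : C →ₗ[R] D)
    (hfg : ∀ a, g (f a) = 0) (hB : ∀ b, g b = 0 → ∃ a, f a = b) (hC : ∀ c, h c = 0 → ∃ b, g b = c)
    {c : C} (hc : c ∈ gammaSubmodule (Ideal.span {x}) C) (hc' : h c = 0) :
    ∃ b ∈ gammaSubmodule (Ideal.span {x}) B, g b = c := by
  obtain ⟨b, rfl⟩ := hC c hc'
  obtain ⟨n, hn⟩ := mem_gammaSubmodule_span_singleton.1 hc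
  obtain ⟨a, ha⟩ := hB (x ^ n • b) (by rw [map_smul, hn])
  obtain ⟨a', k, hk⟩ := exists_pow_smul_sub_mem_torsion hA x n a
  refine ⟨b - f a', mem_gammaSubmodule_span_singleton.2 ⟨k + n, ?_⟩, by rw [map_sub, hfg, sub_zero]⟩
  rw [pow_add, mul_smul, smul_sub, ← ha, ← map_smul, ← map_sub, ← map_smul, hk, map_zero]

/-- If a complex of injective modules is exact in the degrees `> m` and `𝔞` has `s.card`
generators, then `Γ_𝔞` of the complex is exact in the degrees `> m + s.card`. -/
theorem exact_gammaSubmodule_of_injective [IsNoetherianRing R] (s : Finset R)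
    (K : ℤ → Type u') [∀ i, AddCommGroup (K i)] [∀ i, Module R (K i)]
    (hK : ∀ i, Module.Baer R (K i)) (d : ∀ i, K i →ₗ[R] K (i + 1))
    (hd : ∀ i x, d (i + 1) (d i x) = 0) (m : ℤ)
    (hex : ∀ i, m ≤ i → ∀ x, d (i + 1) x = 0 → ∃ y, d i y = x) :
    ∀ i, m + s.card ≤ i → ∀ x ∈ gammaSubmodule (Ideal.span (s : Set R)) (K (i + 1)),
      d (i + 1) x = 0 → ∃ y ∈ gammaSubmodule (Ideal.span (s : Set R)) (K i), d i y = x := by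
  classical
  induction s using Finset.induction_on with
  | empty =>
    intro i hi x _ hx
    obtain ⟨y, hy⟩ := hex i (by simpa using hi) x hx
    refine ⟨y, ?_, hy⟩
    rw [Finset.coe_empty, Ideal.span_empty, gammaSubmodule_bot]
    trivial
  | insert x s hxs ih =>
    intro i hi z hz hdz
    rw [Finset.card_insert_of_notMem hxs] at hi
    push_cast at hi
    set 𝔟 := Ideal.span (s : Set R) with h𝔟
    have hspan : Ideal.span ((insert x s : Finset R) : Set R) = Ideal.span {x} ⊔ 𝔟 := by
      rw [Finset.coe_insert, Ideal.span_insert]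
    rw [hspan] at hz ⊢
    let G : ℤ → Type u' := fun j => gammaSubmodule 𝔟 (K j)
    let e : ∀ j, G j →ₗ[R] G (j + 1) := fun j => (d j).restrict (gammaSubmodule_map 𝔟 (d j))
    have hexG : ∀ j, m + s.card ≤ j → ∀ c : G (j + 1), e (j + 1) c = 0 → ∃ b : G j, e j b = c := by
      intro j hj c hc
      obtain ⟨y, hy, hyc⟩ := ih j hj c.1 c.2 (congrArg Subtype.val hc)
      exact ⟨⟨y, hy⟩, Subtype.ext hyc⟩
    obtain ⟨j, rfl⟩ : ∃ j, i = j + 1 := ⟨i - 1, by ring⟩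
    have hz' : z ∈ gammaSubmodule 𝔟 (K (j + 1 + 1)) := gammaSubmodule_anti le_sup_right _ hz
    have hz'' : (⟨z, hz'⟩ : G (j + 1 + 1)) ∈ gammaSubmodule (Ideal.span {x}) (G (j + 1 + 1)) := by
      obtain ⟨n, hn⟩ := gammaSubmodule_anti (le_sup_left : Ideal.span {x} ≤ _ ⊔ 𝔟) _ hz
      exact ⟨n, fun r hr => Subtype.ext (hn r hr)⟩
    obtain ⟨⟨b, hb⟩, ⟨n, hn⟩, hbz⟩ := exact_gammaSubmodule_span_singleton x
      (baer_gammaSubmodule 𝔟 (hK j)) (e j) (e (j + 1)) (e (j + 1 + 1))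
      (fun a => Subtype.ext (hd j a.1)) (hexG j (by lia)) (hexG (j + 1) (by lia)) hz''
      (Subtype.ext hdz)
    refine ⟨b, mem_gammaSubmodule_sup ⟨n, fun r hr => ?_⟩ hb, congrArg Subtype.val hbz⟩
    exact congrArg Subtype.val (hn r hr)

end InjectiveTorsion

/-! ### Products of complexes of modules -/

section Homology

open HomologicalComplex

variable {R : Type u} [CommRing R]

theorem exists_homologyπ_eq (K : CochainComplex (ModuleCat.{u} R) ℤ) (i : ℤ) (h : K.homology i) :
    ∃ z : K.cycles i, K.homologyπ i z = h :=
  (ModuleCat.epi_iff_surjective (K.homologyπ i)).1 inferInstance h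

theorem homologyπ_eq_zero_iff (K : CochainComplex (ModuleCat.{u} R) ℤ) (i j : ℤ) (hij : i + 1 = j)
    (z : K.cycles j) : K.homologyπ j z = 0 ↔ ∃ y : K.X i, K.d i j y = K.iCycles j z := by
  have hprev : (ComplexShape.up ℤ).prev j = i := (ComplexShape.up ℤ).prev_eq' hij
  have hinj : Function.Injective (K.iCycles j) := (ModuleCat.mono_iff_injective _).1 inferInstance
  have hex : (ShortComplex.mk (K.toCycles i j) (K.homologyπ j)
      (K.toCycles_comp_homologyπ i j)).Exact :=
    ShortComplex.exact_of_g_is_cokernel _ (K.homologyIsCokernel i j hprev)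
  constructor
  · intro hz
    obtain ⟨y, hy⟩ := (ShortComplex.moduleCat_exact_iff _).1 hex z hz
    refine ⟨y, ?_⟩
    rw [← hy, ← ConcreteCategory.comp_apply]
    exact (ConcreteCategory.congr_hom (K.toCycles_i i j) y).symm
  · rintro ⟨y, hy⟩
    have h1 : K.toCycles i j y = z := by
      apply hinj
      rw [← hy, ← ConcreteCategory.comp_apply, K.toCycles_i]
    rw [← h1, ← ConcreteCategory.comp_apply, K.toCycles_comp_homologyπ]
    rfl

theorem exists_iCycles_eq (K : CochainComplex (ModuleCat.{u} R) ℤ) (i j : ℤ) (hij : i + 1 = j)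
    (x : K.X i) (hx : K.d i j x = 0) : ∃ z : K.cycles i, K.iCycles i z = x := by
  have hnext : (ComplexShape.up ℤ).next i = j := (ComplexShape.up ℤ).next_eq' hij
  have hex : (ShortComplex.mk (K.iCycles i) (K.d i j) (K.iCycles_d i j)).Exact :=
    ShortComplex.exact_of_f_is_kernel _ (K.cyclesIsKernel i j hnext)
  exact (ShortComplex.moduleCat_exact_iff _).1 hex x hx

theorem homologyMap_homologyπ {K L : CochainComplex (ModuleCat.{u} R) ℤ} (f : K ⟶ L) (i : ℤ)
    (z : K.cycles i) :
    homologyMap f i (K.homologyπ i z) = L.homologyπ i (cyclesMap f i z) := by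
  rw [← ConcreteCategory.comp_apply, homologyπ_naturality, ConcreteCategory.comp_apply]

theorem iCycles_cyclesMap {K L : CochainComplex (ModuleCat.{u} R) ℤ} (f : K ⟶ L) (i : ℤ)
    (z : K.cycles i) : L.iCycles i (cyclesMap f i z) = f.f i (K.iCycles i z) := by
  rw [← ConcreteCategory.comp_apply, cyclesMap_i, ConcreteCategory.comp_apply]

theorem exactAt_iff (K : CochainComplex (ModuleCat.{u} R) ℤ) (i j k : ℤ) (hij : i + 1 = j)
    (hjk : j + 1 = k) :
    K.ExactAt j ↔ ∀ x : K.X j, K.d j k x = 0 → ∃ y : K.X i, K.d i j y = x := by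
  rw [K.exactAt_iff' i j k ((ComplexShape.up ℤ).prev_eq' hij) ((ComplexShape.up ℤ).next_eq' hjk),
    ShortComplex.moduleCat_exact_iff]
  rfl

variable (I : ℕ → CochainComplex (ModuleCat.{u} R) ℤ)

/-- The product of a sequence of complexes of modules, formed degreewise. -/
def piComplex : CochainComplex (ModuleCat.{u} R) ℤ where
  X i := ModuleCat.of R (∀ n, (I n).X i)
  d i j := ModuleCat.ofHom (LinearMap.pi fun n => ((I n).d i j).hom ∘ₗ LinearMap.proj n)
  shape i j hij := by
    ext x n
    change (I n).d i j (x n) = 0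
    rw [(I n).shape i j hij]
    rfl
  d_comp_d' i j k _ _ := by
    ext x n
    change (I n).d j k ((I n).d i j (x n)) = 0
    rw [← ConcreteCategory.comp_apply, (I n).d_comp_d]
    rfl

/-- The projections of the product complex. -/
def piComplexProj (n : ℕ) : piComplex I ⟶ I n where
  f _ := ModuleCat.ofHom (LinearMap.proj n)
  comm' _ _ _ := rfl

variable {I}

/-- The map to the product complex with given components. -/
def piComplexLift {K : CochainComplex (ModuleCat.{u} R) ℤ} (f : ∀ n, K ⟶ I n) :
    K ⟶ piComplex I where
  f i := ModuleCat.ofHom (LinearMap.pi fun n => ((f n).f i).hom)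
  comm' i j _ := by
    ext x
    funext n
    exact ConcreteCategory.congr_hom ((f n).comm i j) x

theorem piComplexLift_proj {K : CochainComplex (ModuleCat.{u} R) ℤ} (f : ∀ n, K ⟶ I n) (n : ℕ) :
    piComplexLift f ≫ piComplexProj I n = f n := rfl

/-- A map to the product complex is null-homotopic if its components are. -/
noncomputable def piComplexHomotopy {K : CochainComplex (ModuleCat.{u} R) ℤ} (f : K ⟶ piComplex I)
    (h : ∀ n, Homotopy (f ≫ piComplexProj I n) 0) : Homotopy f 0 where
  hom i j := ModuleCat.ofHom (LinearMap.pi fun n => ((h n).hom i j).hom)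
  zero i j hij := by
    ext x n
    exact ConcreteCategory.congr_hom ((h n).zero i j hij) x
  comm i := by
    ext x
    funext n
    exact ConcreteCategory.congr_hom ((h n).comm i) x

instance piComplex_isKInjective [∀ n, (I n).IsKInjective] : (piComplex I).IsKInjective where
  nonempty_homotopy_zero f hK :=
    ⟨piComplexHomotopy f fun _ => CochainComplex.IsKInjective.homotopyZero _ hK⟩

theorem injective_piComplex_X (i : ℤ) (h : ∀ n, Injective ((I n).X i)) :
    Injective ((piComplex I).X i) where
  factors {X Y} g f _ := by
    refine ⟨ModuleCat.ofHom (LinearMap.pi fun n =>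
      (Injective.factorThru (g ≫ (piComplexProj I n).f i) f).hom), ?_⟩
    ext x
    funext n
    exact ConcreteCategory.congr_hom (Injective.comp_factorThru (g ≫ (piComplexProj I n).f i) f) x

theorem piComplex_homology_ext (i : ℤ) (h : (piComplex I).homology i)
    (hh : ∀ n, homologyMap (piComplexProj I n) i h = 0) : h = 0 := by
  obtain ⟨z, rfl⟩ := exists_homologyπ_eq _ i h
  have h1 : ∀ n, ∃ y : (I n).X (i - 1), (I n).d (i - 1) i y =
      (piComplexProj I n).f i ((piComplex I).iCycles i z) := by
    intro n
    have h2 := hh n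
    rw [homologyMap_homologyπ, homologyπ_eq_zero_iff _ (i - 1) i (by ring)] at h2
    obtain ⟨y, hy⟩ := h2
    exact ⟨y, by rw [hy, iCycles_cyclesMap]⟩
  choose y hy using h1
  rw [homologyπ_eq_zero_iff _ (i - 1) i (by ring)]
  exact ⟨y, funext hy⟩

theorem piComplex_homology_surj (i : ℤ) (x : ∀ n, (I n).homology i) :
    ∃ h : (piComplex I).homology i, ∀ n, homologyMap (piComplexProj I n) i h = x n := by
  choose z hz using fun n => exists_homologyπ_eq _ i (x n)
  obtain ⟨t, ht⟩ := exists_iCycles_eq (piComplex I) i (i + 1) rfl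
    (fun n => (I n).iCycles i (z n)) (by
      funext n
      exact ConcreteCategory.congr_hom ((I n).iCycles_d i (i + 1)) (z n))
  refine ⟨(piComplex I).homologyπ i t, fun n => ?_⟩
  rw [homologyMap_homologyπ, ← hz n]
  congr 1
  apply (ModuleCat.mono_iff_injective ((I n).iCycles i)).1 inferInstance
  rw [iCycles_cyclesMap, ht]
  rfl

theorem isKInjective_mappingCocone {K L : CochainComplex (ModuleCat.{u} R) ℤ} (f : K ⟶ L)
    [K.IsKInjective] [L.IsKInjective] : (CochainComplex.mappingCocone f).IsKInjective := by
  have : (CochainComplex.mappingCone f).IsKInjective := by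
    rw [CochainComplex.isKInjective_iff_rightOrthogonal]
    exact ObjectProperty.ext_of_isTriangulatedClosed₃ _
      (CochainComplex.mappingCone.triangleh f) ⟨_, _, f, ⟨Iso.refl _⟩⟩
      (CochainComplex.IsKInjective.rightOrthogonal K)
      (CochainComplex.IsKInjective.rightOrthogonal L)
  dsimp only [CochainComplex.mappingCocone]
  infer_instance

theorem injective_mappingCocone_X {K L : CochainComplex (ModuleCat.{u} R) ℤ} (f : K ⟶ L)
    (hK : ∀ i, Injective (K.X i)) (hL : ∀ i, Injective (L.X i)) (i : ℤ) :
    Injective ((CochainComplex.mappingCocone f).X i) := by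
  have := hK (i + -1 + 1)
  have := hL (i + -1)
  exact Injective.of_iso (homotopyCofiber.XIsoBiprod f (i + -1) (i + -1 + 1) rfl).symm inferInstance

end Homology

/-! ### K-injective resolutions of unbounded complexes -/

section Resolutions

open HomologicalComplex hiding homologyFunctor homologyFunctor_map homologyFunctor_obj
open DerivedCategory Pretriangulated Limits

variable {R : Type u} [CommRing R] [HasDerivedCategory.{w} (ModuleCat.{u} R)]

theorem exists_Q_map_eq {K L : CochainComplex (ModuleCat.{u} R) ℤ} [L.IsKInjective]
    (g : Q.obj K ⟶ Q.obj L) : ∃ f : K ⟶ L, Q.map f = g := by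
  obtain ⟨f', hf'⟩ := (CochainComplex.IsKInjective.Qh_map_bijective
    ((HomotopyCategory.quotient _ _).obj K) L).2
      ((quotientCompQhIso _).hom.app K ≫ g ≫ (quotientCompQhIso _).inv.app L)
  obtain ⟨f, rfl⟩ := (HomotopyCategory.quotient _ _).map_surjective f'
  refine ⟨f, ?_⟩
  rw [← cancel_epi ((quotientCompQhIso (ModuleCat.{u} R)).hom.app K),
    ← quotientCompQhIso_hom_naturality, hf']
  simp

theorem nonempty_homotopy_of_Q_map_eq {K L : CochainComplex (ModuleCat.{u} R) ℤ} [L.IsKInjective]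
    {f g : K ⟶ L} (h : Q.map f = Q.map g) : Nonempty (Homotopy f g) := by
  refine ⟨HomotopyCategory.homotopyOfEq _ _ ((CochainComplex.IsKInjective.Qh_map_bijective
    ((HomotopyCategory.quotient _ _).obj K) L).1 ?_)⟩
  rw [← cancel_mono ((quotientCompQhIso (ModuleCat.{u} R)).hom.app L),
    quotientCompQhIso_hom_naturality, quotientCompQhIso_hom_naturality, h]

/-- A bounded below complex has a K-injective resolution by injective modules with the same
lower bound. -/
theorem exists_resolution_of_isGE (X : DerivedCategory (ModuleCat.{u} R)) (n : ℤ) [X.IsGE n] :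
    ∃ L : CochainComplex (ModuleCat.{u} R) ℤ, L.IsKInjective ∧ (∀ i, Injective (L.X i)) ∧
      L.IsStrictlyGE n ∧ Nonempty (X ≅ Q.obj L) := by
  obtain ⟨K, _, ⟨e⟩⟩ := X.exists_iso_Q_obj_of_isGE n
  obtain ⟨L, i, _, hL, _⟩ := CochainComplex.Plus.modelCategoryQuillen.exists_quasiIso_injective K n
  exact ⟨L, CochainComplex.isKInjective_of_injective L n, hL, inferInstance,
    ⟨e ≪≫ asIso (Q.map i)⟩⟩

theorem homologyFunctorFactors_hom_app_map {K L : CochainComplex (ModuleCat.{u} R) ℤ} (f : K ⟶ L)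
    (i : ℤ) (x : (homologyFunctor (ModuleCat.{u} R) i).obj (Q.obj K)) :
    (homologyFunctorFactors (ModuleCat.{u} R) i).hom.app L
      ((homologyFunctor (ModuleCat.{u} R) i).map (Q.map f) x) =
    homologyMap f i ((homologyFunctorFactors (ModuleCat.{u} R) i).hom.app K x) :=
  ConcreteCategory.congr_hom (homologyFunctorFactors_hom_naturality f i) x

theorem piComplex_homologyFunctor_ext {I : ℕ → CochainComplex (ModuleCat.{u} R) ℤ} (i : ℤ)
    (x y : (homologyFunctor (ModuleCat.{u} R) i).obj (Q.obj (piComplex I)))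
    (h : ∀ n, (homologyFunctor (ModuleCat.{u} R) i).map (Q.map (piComplexProj I n)) x =
      (homologyFunctor (ModuleCat.{u} R) i).map (Q.map (piComplexProj I n)) y) : x = y := by
  rw [← sub_eq_zero]
  apply (ConcreteCategory.bijective_of_isIso
    ((homologyFunctorFactors (ModuleCat.{u} R) i).hom.app (piComplex I))).1
  rw [map_zero]
  refine piComplex_homology_ext i _ fun n => ?_
  refine (homologyFunctorFactors_hom_app_map (piComplexProj I n) i (x - y)).symm.trans ?_
  rw [map_sub, h n, sub_self]
  exact map_zero _

theorem piComplex_homologyFunctor_surj {I : ℕ → CochainComplex (ModuleCat.{u} R) ℤ} (i : ℤ)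
    (x : ∀ n, (homologyFunctor (ModuleCat.{u} R) i).obj (Q.obj (I n))) :
    ∃ y : (homologyFunctor (ModuleCat.{u} R) i).obj (Q.obj (piComplex I)),
      ∀ n, (homologyFunctor (ModuleCat.{u} R) i).map (Q.map (piComplexProj I n)) y = x n := by
  obtain ⟨h, hh⟩ := piComplex_homology_surj (I := I) i
    fun n => (homologyFunctorFactors (ModuleCat.{u} R) i).hom.app (I n) (x n)
  obtain ⟨y, rfl⟩ := (ConcreteCategory.bijective_of_isIso
    ((homologyFunctorFactors (ModuleCat.{u} R) i).hom.app (piComplex I))).2 h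
  refine ⟨y, fun n => ?_⟩
  apply (ConcreteCategory.bijective_of_isIso
    ((homologyFunctorFactors (ModuleCat.{u} R) i).hom.app (I n))).1
  exact (homologyFunctorFactors_hom_app_map (piComplexProj I n) i y).trans (hh n)

theorem truncGEπ_homology_surjective (X : DerivedCategory (ModuleCat.{u} R)) (n i : ℤ) :
    Function.Surjective
      ((homologyFunctor (ModuleCat.{u} R) i).map ((TStructure.t.truncGEπ n).app X)) := by
  by_cases hi : n ≤ i
  · rw [← ModuleCat.epi_iff_surjective]
    refine (HomologySequence.epi_homologyMap_mor₂_iff _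
      (TStructure.t.triangleLTGE_distinguished n X) i (i + 1)).2 ?_
    have : ((TStructure.t.triangleLTGE n).obj X).obj₁.IsLE (n - 1) := inferInstance
    exact (isZero_of_isLE _ (n - 1) (i + 1) (by lia)).eq_of_tgt _ _
  · have : ((TStructure.t.truncGE n).obj X).IsGE n := inferInstance
    rw [← ModuleCat.epi_iff_surjective]
    exact (isZero_of_isGE ((TStructure.t.truncGE n).obj X) n i (by lia)).epi _

theorem truncGEπ_homology_injective (X : DerivedCategory (ModuleCat.{u} R)) (n i : ℤ)
    (hi : n ≤ i) : Function.Injective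
      ((homologyFunctor (ModuleCat.{u} R) i).map ((TStructure.t.truncGEπ n).app X)) := by
  rw [← ModuleCat.mono_iff_injective]
  refine (HomologySequence.mono_homologyMap_mor₂_iff _
      (TStructure.t.triangleLTGE_distinguished n X) i).2 ?_
  have : ((TStructure.t.triangleLTGE n).obj X).obj₁.IsLE (n - 1) := inferInstance
  exact (isZero_of_isLE _ (n - 1) i (by lia)).eq_of_src _ _

/-- Every object of the unbounded derived category of a ring is represented by a K-injective
complex of injective modules: the homotopy limit of resolutions of its truncations
`τ_{≥ -n}`. -/
theorem exists_resolution (X : DerivedCategory (ModuleCat.{u} R)) :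
    ∃ L : CochainComplex (ModuleCat.{u} R) ℤ, L.IsKInjective ∧ (∀ i, Injective (L.X i)) ∧
      Nonempty (X ≅ Q.obj L) := by
  obtain ⟨X', ⟨e₀⟩⟩ : ∃ K, Nonempty (Q.obj K ≅ X) := ⟨_, ⟨Q.objObjPreimageIso X⟩⟩
  have hres := fun n : ℕ =>
    have : ((TStructure.t.truncGE (-(n : ℤ))).obj X).IsGE (-(n : ℤ)) := inferInstance
    exists_resolution_of_isGE ((TStructure.t.truncGE (-(n : ℤ))).obj X) (-(n : ℤ))
  choose I hI hI' _ he using hres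
  have e := fun n => (he n).some
  have hp := fun n : ℕ => exists_Q_map_eq (K := I (n + 1)) (L := I n) ((e (n + 1)).inv ≫
    (TStructure.t.natTransTruncGEOfLE (-((n + 1 : ℕ) : ℤ)) (-(n : ℤ)) (by lia)).app X ≫ (e n).hom)
  choose p hp using hp
  have hφ := fun n : ℕ => exists_Q_map_eq (K := X') (L := I n) (e₀.hom ≫
    (TStructure.t.truncGEπ (-(n : ℤ))).app X ≫ (e n).hom)
  choose φ hφ using hφ
  have hφp : ∀ n, Q.map (φ (n + 1) ≫ p n) = Q.map (φ n) := by
    intro n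
    rw [Q.map_comp, hp, hφ, hφ]
    simp
  -- the cocone of `s`, the identity minus the shift, is the homotopy limit of the tower
  let s : piComplex I ⟶ piComplex I :=
    piComplexLift fun n => piComplexProj I n - piComplexProj I (n + 1) ≫ p n
  have hs : ∀ n, s ≫ piComplexProj I n = piComplexProj I n - piComplexProj I (n + 1) ≫ p n :=
    fun n => piComplexLift_proj _ n
  let Φ : X' ⟶ piComplex I := piComplexLift φ
  have hΦ : ∀ n, Φ ≫ piComplexProj I n = φ n := fun n => piComplexLift_proj _ n
  have hΦs : Q.map Φ ≫ Q.map s = 0 := by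
    rw [← Q.map_comp, ← Q.map_zero]
    have h1 : ∀ n, Nonempty (Homotopy ((Φ ≫ s) ≫ piComplexProj I n) 0) := by
      intro n
      refine nonempty_homotopy_of_Q_map_eq ?_
      rw [Category.assoc, hs, Preadditive.comp_sub, hΦ, ← Category.assoc, hΦ, Q.map_sub, hφp,
        sub_self, Q.map_zero]
    exact DerivedCategory.Q_map_eq_of_homotopy _ (piComplexHomotopy _ fun n => (h1 n).some)
  refine ⟨CochainComplex.mappingCocone s, isKInjective_mappingCocone s,
    injective_mappingCocone_X s (fun i => injective_piComplex_X i fun n => hI' n i)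
      (fun i => injective_piComplex_X i fun n => hI' n i), ?_⟩
  have hT := mappingCocone_triangle_distinguished s
  obtain ⟨ψ, hψ⟩ : ∃ ψ : Q.obj X' ⟶ Q.obj (CochainComplex.mappingCocone s),
      Q.map Φ = ψ ≫ Q.map (CochainComplex.mappingCocone.fst s) :=
    Triangle.coyoneda_exact₂ _ hT (Q.map Φ) hΦs
  suffices hiso : IsIso ψ from ⟨e₀.symm ≪≫ @asIso _ _ _ _ ψ hiso⟩
  rw [DerivedCategory.isIso_iff]
  intro i
  let H := fun j => homologyFunctor (ModuleCat.{u} R) j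
  -- the homology of the truncations is that of `X` or zero
  have hφsurj : ∀ j n, Function.Surjective ((H j).map (Q.map (φ n))) := by
    intro j n
    rw [hφ, Functor.map_comp, Functor.map_comp, ← ModuleCat.epi_iff_surjective]
    have : Epi ((H j).map ((TStructure.t.truncGEπ (-(n : ℤ))).app X)) :=
      (ModuleCat.epi_iff_surjective _).2 (truncGEπ_homology_surjective X _ j)
    infer_instance
  have hφinj : ∀ n : ℕ, -(n : ℤ) ≤ i → Function.Injective ((H i).map (Q.map (φ n))) := by
    intro n hn
    rw [hφ, Functor.map_comp, Functor.map_comp, ← ModuleCat.mono_iff_injective]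
    have : Mono ((H i).map ((TStructure.t.truncGEπ (-(n : ℤ))).app X)) :=
      (ModuleCat.mono_iff_injective _).2 (truncGEπ_homology_injective X _ i hn)
    infer_instance
  have hφp' : ∀ j n x, (H j).map (Q.map (p n)) ((H j).map (Q.map (φ (n + 1))) x) =
      (H j).map (Q.map (φ n)) x := by
    intro j n x
    rw [← hφp n, Q.map_comp, Functor.map_comp]
    rfl
  have hs' : ∀ j n x, (H j).map (Q.map (piComplexProj I n)) ((H j).map (Q.map s) x) =
      (H j).map (Q.map (piComplexProj I n)) x -
        (H j).map (Q.map (p n)) ((H j).map (Q.map (piComplexProj I (n + 1))) x) := by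
    intro j n x
    have h1 : (H j).map (Q.map s) ≫ (H j).map (Q.map (piComplexProj I n)) =
        (H j).map (Q.map (piComplexProj I n)) -
          (H j).map (Q.map (piComplexProj I (n + 1))) ≫ (H j).map (Q.map (p n)) := by
      rw [← Functor.map_comp, ← Functor.map_comp, ← Functor.map_comp, ← Functor.map_comp, hs,
        Functor.map_sub, Functor.map_sub]
    exact ConcreteCategory.congr_hom h1 x
  have hΦ' : ∀ n x, (H i).map (Q.map (piComplexProj I n)) ((H i).map (Q.map Φ) x) =
      (H i).map (Q.map (φ n)) x := by
    intro n x
    rw [← hΦ n, Q.map_comp, Functor.map_comp]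
    rfl
  have hssurj : ∀ j, Epi ((H j).map (Q.map s)) := by
    intro j
    rw [ModuleCat.epi_iff_surjective]
    intro y
    have hb : ∀ n, Function.Surjective ((H j).map (Q.map (p n))) := fun n z => by
      obtain ⟨x, rfl⟩ := hφsurj j n z
      exact ⟨_, hφp' j n x⟩
    choose c hc using hb
    -- a preimage of `y` is found recursively along the tower
    let x : ∀ n, (H j).obj (Q.obj (I n)) := fun n => Nat.rec 0
      (fun n xn => c n (xn - (H j).map (Q.map (piComplexProj I n)) y)) n
    obtain ⟨z, hz⟩ := piComplex_homologyFunctor_surj j x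
    refine ⟨z, piComplex_homologyFunctor_ext j _ _ fun n => ?_⟩
    rw [hs', hz, hz]
    change x n - (H j).map (Q.map (p n)) (c n (x n - _)) = _
    rw [hc, sub_sub_cancel]
  have hfst : Function.Injective ((H i).map (Q.map (CochainComplex.mappingCocone.fst s))) := by
    rw [← ModuleCat.mono_iff_injective]
    refine (HomologySequence.mono_homologyMap_mor₁_iff _ hT (i - 1) i).2 ?_
    exact (HomologySequence.epi_homologyMap_mor₂_iff _ hT (i - 1) i).1 (hssurj (i - 1))
  have hψ' : ∀ x, (H i).map (Q.map (CochainComplex.mappingCocone.fst s)) ((H i).map ψ x) =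
      (H i).map (Q.map Φ) x := by
    intro x
    rw [hψ, Functor.map_comp]
    rfl
  rw [ConcreteCategory.isIso_iff_bijective]
  constructor
  · intro x y hxy
    apply hφinj i.natAbs (by lia)
    rw [← hΦ', ← hΦ', ← hψ', ← hψ']
    exact congrArg _ (congrArg _ hxy)
  · intro y
    have hxs : (H i).map (Q.map s) ((H i).map (Q.map (CochainComplex.mappingCocone.fst s)) y) = 0 :=
      (ShortComplex.moduleCat_zero_apply (ShortComplex.mk
        ((H i).map (Q.map (CochainComplex.mappingCocone.fst s))) ((H i).map (Q.map s)) (by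
          rw [← Functor.map_comp, ← Functor.map_zero (H i)]
          exact congrArg _ (comp_distTriang_mor_zero₁₂ _ hT))) y)
    set x := (H i).map (Q.map (CochainComplex.mappingCocone.fst s)) y with hx
    -- `x` is a compatible family of classes in the homology of the truncations
    have hstep : ∀ n, (H i).map (Q.map (p n)) ((H i).map (Q.map (piComplexProj I (n + 1))) x) =
        (H i).map (Q.map (piComplexProj I n)) x := by
      intro n
      have h1 := hs' i n x
      rw [hxs, map_zero] at h1
      exact (sub_eq_zero.1 h1.symm).symm
    have hdown : ∀ n m, n ≤ m → ∀ z, (H i).map (Q.map (φ m)) z =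
        (H i).map (Q.map (piComplexProj I m)) x → (H i).map (Q.map (φ n)) z =
        (H i).map (Q.map (piComplexProj I n)) x := by
      intro n m hnm
      induction m, hnm using Nat.le_induction with
      | base => exact fun z hz => hz
      | succ m _ ih =>
        intro z hz
        refine ih z ?_
        rw [← hφp' i m z, hz, hstep]
    obtain ⟨z, hz⟩ := hφsurj i i.natAbs ((H i).map (Q.map (piComplexProj I i.natAbs)) x)
    refine ⟨z, hfst ?_⟩
    rw [hψ', ← hx]
    refine piComplex_homologyFunctor_ext i _ _ fun n => ?_
    refine (hΦ' n z).trans ?_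
    obtain ⟨z', hz'⟩ := hφsurj i (max n i.natAbs)
      ((H i).map (Q.map (piComplexProj I (max n i.natAbs))) x)
    have h1 : z' = z := hφinj i.natAbs (by lia)
      ((hdown _ _ (le_max_right _ _) z' hz').trans hz.symm)
    rw [← h1]
    exact hdown _ _ (le_max_left _ _) z' hz'

end Resolutions

/-! ### The derived torsion functor -/

section DerivedFunctor

open DerivedCategory Functor

section Adjunction

variable {C D H : Type*} [Category* C] [Category* D] [Category* H] {L : C ⥤ D} {ρ : D ⥤ C}

/-- The unit `G ⟶ L ⋙ ρ ⋙ G` induced by an adjunction `L ⊣ ρ`. -/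
abbrev whiskerUnit (adj : L ⊣ ρ) (G : C ⥤ H) : G ⟶ L ⋙ ρ ⋙ G :=
  G.leftUnitor.inv ≫ whiskerRight adj.unit G ≫ (Functor.associator _ _ _).hom

/-- Precomposition with a right adjoint `ρ` of `L` is the left Kan extension along `L`. -/
theorem isLeftKanExtension_of_adjunction (adj : L ⊣ ρ) (G : C ⥤ H) :
    (ρ ⋙ G).IsLeftKanExtension (whiskerUnit adj G) :=
  have h : (adj.whiskerLeft H).unit.app G = whiskerUnit adj G := by
    ext X
    simp
  h ▸ ⟨⟨mkInitialOfLeftAdjoint _ (adj.whiskerLeft H) G⟩⟩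

end Adjunction

variable {R : Type u} [CommRing R] [HasDerivedCategory.{w} (ModuleCat.{u} R)]

/-- By the existence of K-injective resolutions, the localization functor `K(R) ⥤ D(R)` has a
right adjoint. -/
theorem exists_adjunction_Qh : ∃ ρ : DerivedCategory (ModuleCat.{u} R) ⥤
    HomotopyCategory (ModuleCat.{u} R) (ComplexShape.up ℤ), Nonempty (Qh ⊣ ρ) := by
  choose L hL _ hLe using exists_resolution (R := R)
  let e : ∀ (X : HomotopyCategory (ModuleCat.{u} R) (ComplexShape.up ℤ))
      (Y : DerivedCategory (ModuleCat.{u} R)),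
      (X ⟶ (HomotopyCategory.quotient _ _).obj (L Y)) ≃ (Qh.obj X ⟶ Y) := fun X Y =>
    (Equiv.ofBijective _ (CochainComplex.IsKInjective.Qh_map_bijective X (L Y))).trans
      (((quotientCompQhIso _).app (L Y) ≪≫ (hLe Y).some.symm).homToEquiv)
  have he : ∀ X Y f, e X Y f =
      Qh.map f ≫ ((quotientCompQhIso _).app (L Y) ≪≫ (hLe Y).some.symm).hom := fun _ _ _ => rfl
  refine ⟨Adjunction.rightAdjointOfEquiv (fun X Y => (e X Y).symm) ?_,
    ⟨Adjunction.adjunctionOfEquivRight (fun X Y => (e X Y).symm) _⟩⟩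
  intro X' X Y f g
  rw [Equiv.symm_apply_eq, he, Functor.map_comp, Category.assoc, ← he, Equiv.apply_symm_apply]

variable (𝔞 : Ideal R)

theorem exists_isRGamma : ∃ (RΓ : DerivedCategory (ModuleCat.{u} R) ⥤
    DerivedCategory (ModuleCat.{u} R)) (α : gammaHomotopy 𝔞 ⟶ Qh ⋙ RΓ), IsRGamma 𝔞 RΓ α := by
  obtain ⟨ρ, ⟨adj⟩⟩ := exists_adjunction_Qh (R := R)
  exact ⟨_, _, ⟨isLeftKanExtension_of_adjunction adj (gammaHomotopy 𝔞)⟩⟩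

variable {𝔞} {RΓ : DerivedCategory (ModuleCat.{u} R) ⥤ DerivedCategory (ModuleCat.{u} R)}
  {α : gammaHomotopy 𝔞 ⟶ Qh ⋙ RΓ}

theorem exists_iso_of_isRGamma (h : IsRGamma 𝔞 RΓ α)
    {ρ : DerivedCategory (ModuleCat.{u} R) ⥤
      HomotopyCategory (ModuleCat.{u} R) (ComplexShape.up ℤ)} (adj : Qh ⊣ ρ) :
    ∃ e : ρ ⋙ gammaHomotopy 𝔞 ≅ RΓ,
      whiskerUnit adj (gammaHomotopy 𝔞) ≫ whiskerLeft Qh e.hom = α := by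
  have hK : IsRGamma 𝔞 (ρ ⋙ gammaHomotopy 𝔞) (whiskerUnit adj (gammaHomotopy 𝔞)) :=
    ⟨isLeftKanExtension_of_adjunction adj (gammaHomotopy 𝔞)⟩
  exact ⟨rightDerivedUnique _ _ (whiskerUnit adj (gammaHomotopy 𝔞)) α
      (HomotopyCategory.quasiIso _ _),
    (rightDerivedNatTrans_fac (ρ ⋙ gammaHomotopy 𝔞) RΓ (whiskerUnit adj (gammaHomotopy 𝔞)) α
      (HomotopyCategory.quasiIso _ _) (𝟙 _)).trans (Category.id_comp α)⟩

theorem isTriangulated_of_isRGamma (h : IsRGamma 𝔞 RΓ α) :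
    ∃ _ : RΓ.CommShift ℤ, NatTrans.CommShift α ℤ ∧ RΓ.IsTriangulated := by
  obtain ⟨ρ, ⟨adj⟩⟩ := exists_adjunction_Qh (R := R)
  let _ : ρ.CommShift ℤ := adj.rightAdjointCommShift ℤ
  have : adj.CommShift ℤ := adj.commShift_of_leftAdjoint ℤ
  have : ρ.IsTriangulated := adj.isTriangulated_rightAdjoint
  obtain ⟨e, hα⟩ := exists_iso_of_isRGamma h adj
  let _ : RΓ.CommShift ℤ := CommShift.ofIso e ℤ
  have : NatTrans.CommShift e.hom ℤ := CommShift.ofIso_compatibility e ℤ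
  refine ⟨inferInstance, ?_, isTriangulated_of_iso e⟩
  rw [← hα]
  infer_instance

/-- The derived functor is computed by K-injective complexes. -/
theorem isIso_app_of_isKInjective (h : IsRGamma 𝔞 RΓ α) (I : CochainComplex (ModuleCat.{u} R) ℤ)
    [I.IsKInjective] : IsIso (α.app ((HomotopyCategory.quotient _ _).obj I)) := by
  obtain ⟨ρ, ⟨adj⟩⟩ := exists_adjunction_Qh (R := R)
  obtain ⟨e, hα⟩ := exists_iso_of_isRGamma h adj
  set X := (HomotopyCategory.quotient (ModuleCat.{u} R) (ComplexShape.up ℤ)).obj I with hX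
  -- as `X` is K-injective, maps into it are the same in `K(R)` and in `D(R)`
  have hunit : IsIso (adj.unit.app X) := by
    refine isIso_of_yoneda_map_bijective _ fun A => ?_
    refine (Function.Bijective.of_comp_iff' (adj.homEquiv A (Qh.obj X)).symm.bijective _).1 ?_
    have h1 : ⇑(adj.homEquiv A (Qh.obj X)).symm ∘ (fun g : A ⟶ X => g ≫ adj.unit.app X) =
        Qh.map := by
      funext g
      change (adj.homEquiv A (Qh.obj X)).symm (g ≫ adj.unit.app X) = Qh.map g
      rw [Equiv.symm_apply_eq, Adjunction.homEquiv_unit]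
      exact adj.unit.naturality g
    exact h1 ▸ CochainComplex.IsKInjective.Qh_map_bijective A I
  have h2 : IsIso ((gammaHomotopy 𝔞).map (adj.unit.app X)) := inferInstance
  have h3 : IsIso (e.hom.app (Qh.obj X)) := inferInstance
  rw [← congr_app hα X]
  change IsIso ((𝟙 _ ≫ (gammaHomotopy 𝔞).map (adj.unit.app X) ≫ 𝟙 _) ≫ e.hom.app (Qh.obj X))
  rw [Category.id_comp, Category.comp_id]
  exact IsIso.comp_isIso' h2 h3

/-- The derived torsion of a K-injective complex is its degreewise torsion. -/
theorem iso_of_isKInjective (h : IsRGamma 𝔞 RΓ α) (I : CochainComplex (ModuleCat.{u} R) ℤ)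
    [I.IsKInjective] : Nonempty (RΓ.obj (Q.obj I) ≅
      Q.obj (((gammaFunctor 𝔞).mapHomologicalComplex (ComplexShape.up ℤ)).obj I)) := by
  have := isIso_app_of_isKInjective h I
  exact ⟨RΓ.mapIso ((quotientCompQhIso _).symm.app I) ≪≫
    (asIso (α.app ((HomotopyCategory.quotient _ _).obj I))).symm ≪≫
    Qh.mapIso (((gammaFunctor 𝔞).mapHomotopyCategoryFactors (ComplexShape.up ℤ)).app I) ≪≫
    (quotientCompQhIso _).app _⟩

end DerivedFunctor

/-! ### Cofinite modules -/

section Cofinite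

open Abelian

variable {R : Type u} [CommRing R] {𝔞 : Ideal R}

theorem cofinite_of_finite [IsNoetherianRing R] {M : ModuleCat.{u} R} [Module.Finite R M]
    (h : Module.support R M ⊆ PrimeSpectrum.zeroLocus (𝔞 : Set R)) : cofinite 𝔞 M :=
  ⟨h, fun _ => inferInstance⟩

theorem cofinite_of_subsingleton [IsNoetherianRing R] (M : ModuleCat.{u} R) [Subsingleton M] :
    cofinite 𝔞 M :=
  cofinite_of_finite (by simp [Module.support_eq_empty])

theorem cofinite_of_iso {M N : ModuleCat.{u} R} (e : M ≅ N) (h : cofinite 𝔞 M) :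
    cofinite 𝔞 N := by
  refine ⟨(LinearEquiv.support_eq e.toLinearEquiv).symm.le.trans h.1, fun i => ?_⟩
  have := h.2 i
  refine Module.Finite.of_surjective
    ((Ext.mk₀ e.hom).postcompOfLinear R (ModuleCat.of R (R ⧸ 𝔞)) (add_zero i)) fun y =>
      ⟨y.comp (Ext.mk₀ e.inv) (add_zero i), ?_⟩
  simp

section ShortExact

variable [IsNoetherianRing R] {S : ShortComplex (ModuleCat.{u} R)}

/-- The long exact sequence of `Ext` bounds the middle term of a short exact sequence. -/
theorem cofinite_X₂ (hS : S.ShortExact) (h₁ : cofinite 𝔞 S.X₁) (h₃ : cofinite 𝔞 S.X₃) :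
    cofinite 𝔞 S.X₂ := by
  refine ⟨?_, fun i => ?_⟩
  · rw [Module.support_of_exact
      ((ShortComplex.ShortExact.moduleCat_exact_iff_function_exact _).1 hS.exact)
      hS.moduleCat_injective_f hS.moduleCat_surjective_g]
    exact Set.union_subset h₁.1 h₃.1
  · have := h₁.2 i
    have := h₃.2 i
    have := isNoetherian_of_range_eq_ker
      ((Ext.mk₀ S.f).postcompOfLinear R (ModuleCat.of R (R ⧸ 𝔞)) (add_zero i))
      ((Ext.mk₀ S.g).postcompOfLinear R (ModuleCat.of R (R ⧸ 𝔞)) (add_zero i)) <| by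
        refine le_antisymm ?_ fun x hx => Ext.covariant_sequence_exact₂ _ hS x hx
        rintro _ ⟨x, rfl⟩
        simp
    infer_instance

/-- The long exact sequence of `Ext` bounds the last term of a short exact sequence. -/
theorem cofinite_X₃ (hS : S.ShortExact) (h₁ : cofinite 𝔞 S.X₁) (h₂ : cofinite 𝔞 S.X₂) :
    cofinite 𝔞 S.X₃ := by
  refine ⟨(Module.support_subset_of_surjective _ hS.moduleCat_surjective_g).trans h₂.1,
    fun i => ?_⟩
  have := h₁.2 (i + 1)
  have := h₂.2 i
  have := isNoetherian_of_range_eq_ker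
    ((Ext.mk₀ S.g).postcompOfLinear R (ModuleCat.of R (R ⧸ 𝔞)) (add_zero i))
    (hS.extClass.postcompOfLinear R (ModuleCat.of R (R ⧸ 𝔞)) rfl) <| by
      refine le_antisymm ?_ fun x hx => Ext.covariant_sequence_exact₃ _ hS x rfl hx
      rintro _ ⟨x, rfl⟩
      simp [Ext.comp_assoc_of_second_deg_zero]
  infer_instance

end ShortExact

section Kernels

variable [IsNoetherianRing R] {A B : ModuleCat.{u} R}

theorem cofinite_span_singleton (hA : cofinite 𝔞 A) (x : A) :
    cofinite 𝔞 (ModuleCat.of R (Submodule.span R {x})) :=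
  cofinite_of_finite ((Module.support_subset_of_injective (Submodule.subtype _)
    Subtype.val_injective).trans hA.1)

/-- If the cofinite modules have equalizers, then these are the usual kernels: the finitely
generated submodules of a cofinite module are cofinite, so that both the injectivity of the
equalizer and its image can be tested on cyclic modules. -/
theorem cofinite_ker [Limits.HasEqualizers (cofinite 𝔞).FullSubcategory] (f : A ⟶ B)
    (hA : cofinite 𝔞 A) (hB : cofinite 𝔞 B) :
    cofinite 𝔞 (ModuleCat.of R (LinearMap.ker f.hom)) := by
  let f' : (⟨A, hA⟩ : (cofinite 𝔞).FullSubcategory) ⟶ ⟨B, hB⟩ := ObjectProperty.homMk f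
  let g' : (⟨A, hA⟩ : (cofinite 𝔞).FullSubcategory) ⟶ ⟨B, hB⟩ := ObjectProperty.homMk 0
  let E := Limits.equalizer f' g'
  let ι := (Limits.equalizer.ι f' g').hom
  have hι : ι ≫ f = 0 := by
    have h := congrArg InducedCategory.Hom.hom (Limits.equalizer.condition f' g')
    exact h.trans Limits.comp_zero
  let c {M : ModuleCat.{u} R} (hM : cofinite 𝔞 M) (x : M) : (cofinite 𝔞).FullSubcategory :=
    ⟨_, cofinite_span_singleton hM x⟩
  have hinj : Function.Injective ι.hom := by
    rw [injective_iff_map_eq_zero]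
    intro y hy
    let i : c E.property y ⟶ E :=
      ObjectProperty.homMk (ModuleCat.ofHom (Submodule.subtype (Submodule.span R {y})))
    let o : c E.property y ⟶ E := ObjectProperty.homMk 0
    have hio : i = o := by
      refine Limits.equalizer.hom_ext (ObjectProperty.hom_ext _ ?_)
      ext ⟨z, hz⟩
      obtain ⟨r, rfl⟩ := Submodule.mem_span_singleton.1 hz
      change ι.hom (r • y) = ι.hom 0
      rw [map_smul, hy, smul_zero, map_zero]
    have h := congrArg (fun k : c E.property y ⟶ E =>
      k.hom.hom ⟨y, Submodule.mem_span_singleton_self y⟩) hio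
    exact h
  have hrange : LinearMap.range ι.hom = LinearMap.ker f.hom := by
    refine le_antisymm ?_ fun x hx => ?_
    · rintro _ ⟨x, rfl⟩
      exact congrArg (fun k : _ ⟶ B => k.hom x) hι
    · let i : c hA x ⟶ ⟨A, hA⟩ :=
        ObjectProperty.homMk (ModuleCat.ofHom (Submodule.subtype (Submodule.span R {x})))
      have hi : i ≫ f' = i ≫ g' := by
        refine ObjectProperty.hom_ext _ ?_
        ext ⟨z, hz⟩
        obtain ⟨r, rfl⟩ := Submodule.mem_span_singleton.1 hz
        change f.hom (r • x) = 0
        rw [map_smul, LinearMap.mem_ker.1 hx, smul_zero]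
      have h := congrArg (fun k : c hA x ⟶ ⟨A, hA⟩ =>
        k.hom.hom ⟨x, Submodule.mem_span_singleton_self x⟩) (Limits.equalizer.lift_ι i hi)
      exact ⟨_, h⟩
  exact cofinite_of_iso (((LinearEquiv.ofInjective ι.hom hinj).trans
    (LinearEquiv.ofEq _ _ hrange)).toModuleIso) E.property

theorem cofinite_range [Limits.HasEqualizers (cofinite 𝔞).FullSubcategory] (f : A ⟶ B)
    (hA : cofinite 𝔞 A) (hB : cofinite 𝔞 B) :
    cofinite 𝔞 (ModuleCat.of R (LinearMap.range f.hom)) := by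
  have hS : (ShortComplex.mk (ModuleCat.ofHom (LinearMap.ker f.hom).subtype)
      (ModuleCat.ofHom f.hom.rangeRestrict)
      (by ext x; exact LinearMap.mem_ker.1 x.2)).ShortExact := by
    refine ModuleCat.shortComplex_shortExact _ ?_ Subtype.val_injective
      f.hom.surjective_rangeRestrict
    exact LinearMap.exact_iff.2 (by simp)
  exact cofinite_X₃ hS (cofinite_ker f hA hB) hA

theorem cofinite_quotient_range [Limits.HasEqualizers (cofinite 𝔞).FullSubcategory] (f : A ⟶ B)
    (hA : cofinite 𝔞 A) (hB : cofinite 𝔞 B) :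
    cofinite 𝔞 (ModuleCat.of R (B ⧸ LinearMap.range f.hom)) := by
  have hS : (ShortComplex.mk (ModuleCat.ofHom (LinearMap.range f.hom).subtype)
      (ModuleCat.ofHom (LinearMap.range f.hom).mkQ)
      (by ext x; exact (Submodule.Quotient.mk_eq_zero _).2 x.2)).ShortExact := by
    refine ModuleCat.shortComplex_shortExact _ ?_ Subtype.val_injective
      (Submodule.mkQ_surjective _)
    exact LinearMap.exact_iff.2 (by simp)
  exact cofinite_X₃ hS (cofinite_range f hA hB) hB

/-- In an exact sequence `A ⟶ B ⟶ C ⟶ D ⟶ E`, the module `C` is an extension of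
`ker (D ⟶ E)` by `coker (A ⟶ B)`. -/
theorem cofinite_of_exact [Limits.HasEqualizers (cofinite 𝔞).FullSubcategory]
    {C D E : ModuleCat.{u} R} {f : A ⟶ B} {g : B ⟶ C} {h : C ⟶ D} {k : D ⟶ E}
    (hfg : Function.Exact f.hom g.hom) (hgh : Function.Exact g.hom h.hom)
    (hhk : Function.Exact h.hom k.hom)
    (hA : cofinite 𝔞 A) (hB : cofinite 𝔞 B) (hD : cofinite 𝔞 D) (hE : cofinite 𝔞 E) :
    cofinite 𝔞 C := by
  have h₁ : cofinite 𝔞 (ModuleCat.of R (LinearMap.range g.hom)) :=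
    cofinite_of_iso ((Submodule.quotEquivOfEq _ _ hfg.linearMap_ker_eq.symm).trans
      g.hom.quotKerEquivRange).toModuleIso (cofinite_quotient_range f hA hB)
  have h₃ : cofinite 𝔞 (ModuleCat.of R (LinearMap.range h.hom)) :=
    cofinite_of_iso (LinearEquiv.ofEq _ _ hhk.linearMap_ker_eq).toModuleIso
      (cofinite_ker k hD hE)
  have hS : (ShortComplex.mk (ModuleCat.ofHom (LinearMap.range g.hom).subtype)
      (ModuleCat.ofHom h.hom.rangeRestrict)
      (by ext ⟨_, x, rfl⟩; exact hgh.apply_apply_eq_zero x)).ShortExact := by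
    refine ModuleCat.shortComplex_shortExact _ ?_ Subtype.val_injective
      h.hom.surjective_rangeRestrict
    exact LinearMap.exact_iff.2 (by simp [hgh.linearMap_ker_eq])
  exact cofinite_X₂ hS h₁ h₃

end Kernels

/-- Equalizers only refer to the category structure, so the zero morphisms and the addition of the
given abelian structure need not be compared with those of modules. -/
theorem hasEqualizers_of_abelian (h : Nonempty (Abelian (cofinite 𝔞).FullSubcategory)) :
    Limits.HasEqualizers (cofinite 𝔞).FullSubcategory := by
  obtain ⟨h⟩ := h
  infer_instance

end Cofinite

/-! ### The derived torsion functor is way-out -/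

section WayOut

open DerivedCategory

variable {R : Type u} [CommRing R] [HasDerivedCategory.{w} (ModuleCat.{u} R)] {𝔞 : Ideal R}
  {RΓ : DerivedCategory (ModuleCat.{u} R) ⥤ DerivedCategory (ModuleCat.{u} R)}
  {α : gammaHomotopy 𝔞 ⟶ Qh ⋙ RΓ}

/-- Bounds on homology in homological grading are bounds in cohomological grading with the opposite
sign. -/
theorem homologySup_le_iff (X : DerivedCategory (ModuleCat.{u} R)) (m : ℤ) :
    homologySup X ≤ ((m : ℝ) : EReal) ↔ X.IsGE (-m) := by
  rw [isGE_iff, homologySup, sSup_le_iff]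
  constructor
  · intro h i hi
    by_contra hX
    have h1 := h _ ⟨-i, by rwa [homologyModule, neg_neg], rfl⟩
    rw [EReal.coe_le_coe_iff, Int.cast_le] at h1
    omega
  · rintro h _ ⟨i, hi, rfl⟩
    rw [EReal.coe_le_coe_iff, Int.cast_le]
    by_contra! hX
    exact hi (h _ (by omega))

theorem le_homologyInf_iff (X : DerivedCategory (ModuleCat.{u} R)) (m : ℤ) :
    ((m : ℝ) : EReal) ≤ homologyInf X ↔ X.IsLE (-m) := by
  rw [isLE_iff, homologyInf, le_sInf_iff]
  constructor
  · intro h i hi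
    by_contra hX
    have h1 := h _ ⟨-i, by rwa [homologyModule, neg_neg], rfl⟩
    rw [EReal.coe_le_coe_iff, Int.cast_le] at h1
    omega
  · rintro h _ ⟨i, hi, rfl⟩
    rw [EReal.coe_le_coe_iff, Int.cast_le]
    by_contra! hX
    exact hi (h _ (by omega))

theorem isGE_obj_of_isRGamma (h : IsRGamma 𝔞 RΓ α) (X : DerivedCategory (ModuleCat.{u} R))
    (n : ℤ) [X.IsGE n] : (RΓ.obj X).IsGE n := by
  obtain ⟨L, _, _, hL, ⟨e⟩⟩ := exists_resolution_of_isGE X n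
  obtain ⟨e'⟩ := iso_of_isKInjective h L
  have : CochainComplex.IsStrictlyGE
      (((gammaFunctor 𝔞).mapHomologicalComplex (ComplexShape.up ℤ)).obj L) n := by
    rw [CochainComplex.isStrictlyGE_iff] at hL ⊢
    exact fun i hi => (gammaFunctor 𝔞).map_isZero (hL i hi)
  exact TStructure.t.isGE_of_iso (RΓ.mapIso e ≪≫ e').symm n

/-- The cohomological dimension of `Γ_𝔞` is at most the number of generators of `𝔞`. -/
theorem isLE_obj_of_isRGamma [IsNoetherianRing R] (s : Finset R)
    (hs : Ideal.span (s : Set R) = 𝔞) (h : IsRGamma 𝔞 RΓ α)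
    (X : DerivedCategory (ModuleCat.{u} R)) (m : ℤ) [X.IsLE m] :
    (RΓ.obj X).IsLE (m + s.card) := by
  subst hs
  obtain ⟨L, _, hL, ⟨e⟩⟩ := exists_resolution X
  obtain ⟨e'⟩ := iso_of_isKInjective h L
  have hLm : L.IsLE m := (isLE_Q_obj_iff L m).1 (TStructure.t.isLE_of_iso e m)
  have : CochainComplex.IsLE (((gammaFunctor (Ideal.span (s : Set R))).mapHomologicalComplex
      (ComplexShape.up ℤ)).obj L) (m + s.card) := by
    rw [CochainComplex.isLE_iff] at hLm ⊢
    intro i hi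
    obtain ⟨j, rfl⟩ : ∃ j, j + 1 = i := ⟨i - 1, by ring⟩
    rw [exactAt_iff _ j (j + 1) (j + 1 + 1) rfl rfl]
    rintro ⟨x, hx⟩ hdx
    obtain ⟨y, hy, hyx⟩ := exact_gammaSubmodule_of_injective s (fun i => L.X i)
      (fun i => Module.Baer.of_injective (have := hL i
        Module.injective_module_of_injective_object R (L.X i)))
      (fun i => (L.d i (i + 1)).hom)
      (fun i x => ConcreteCategory.congr_hom (L.d_comp_d i (i + 1) (i + 1 + 1)) x) m
      (fun i hi => (exactAt_iff L i (i + 1) (i + 1 + 1) rfl rfl).1 (hLm _ (by omega)))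
      j (by omega) x hx (congrArg Subtype.val hdx)
    exact ⟨⟨y, hy⟩, Subtype.ext hyx⟩
  exact TStructure.t.isLE_of_iso (RΓ.mapIso e ≪≫ e').symm _

theorem isWayOut_of_isRGamma [IsNoetherianRing R] (h : IsRGamma 𝔞 RΓ α) : IsWayOut RΓ := by
  obtain ⟨s, hs⟩ := IsNoetherian.noetherian 𝔞
  refine ⟨fun n => ⟨n, fun X hX => ?_⟩, fun n => ⟨n + s.card, fun X hX => ?_⟩⟩
  · rw [homologySup_le_iff] at hX ⊢
    exact isGE_obj_of_isRGamma h X _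
  · rw [le_homologyInf_iff] at hX ⊢
    have h1 := isLE_obj_of_isRGamma s hs h X (-(n + s.card))
    exact TStructure.t.isLE_of_le _ (-(n + s.card) + s.card) _ (by omega)

end WayOut

/-! ### Cofiniteness of local cohomology -/

section LocalCohomology

open DerivedCategory Pretriangulated

variable {R : Type u} [CommRing R] [HasDerivedCategory.{w} (ModuleCat.{u} R)]

theorem finite_truncGE_homology (X : DerivedCategory (ModuleCat.{u} R))
    (hX : ∀ i, Module.Finite R ((homologyFunctor (ModuleCat.{u} R) i).obj X)) (n i : ℤ) :
    Module.Finite R ((homologyFunctor (ModuleCat.{u} R) i).obj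
      ((TStructure.t.truncGE n).obj X)) := by
  by_cases hi : i < n
  · have := ModuleCat.subsingleton_of_isZero
      (isZero_of_isGE ((TStructure.t.truncGE n).obj X) n i hi)
    infer_instance
  · have h := (HomologySequence.exact₃ _ (TStructure.t.triangleLTGE_distinguished n X) i
      (i + 1) rfl)
    rw [ShortComplex.moduleCat_exact_iff] at h
    have h0 := ModuleCat.subsingleton_of_isZero
      (isZero_of_isLE ((TStructure.t.truncLT n).obj X) (n - 1) (i + 1) (by omega))
    have : Module.Finite R ((homologyFunctor (ModuleCat.{u} R) i).obj ((𝟭 _).obj X)) := hX i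
    exact Module.Finite.of_surjective ((homologyFunctor (ModuleCat.{u} R) i).map
      ((TStructure.t.truncGEπ n).app X)).hom fun x => h x (h0.elim _ _)

variable [IsNoetherianRing R]

theorem finite_truncLT_homology (X : DerivedCategory (ModuleCat.{u} R))
    (hX : ∀ i, Module.Finite R ((homologyFunctor (ModuleCat.{u} R) i).obj X)) (n i : ℤ) :
    Module.Finite R ((homologyFunctor (ModuleCat.{u} R) i).obj
      ((TStructure.t.truncLT n).obj X)) := by
  by_cases hi : n - 1 < i
  · have := ModuleCat.subsingleton_of_isZero
      (isZero_of_isLE ((TStructure.t.truncLT n).obj X) (n - 1) i hi)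
    infer_instance
  · have h := (HomologySequence.exact₁ _ (TStructure.t.triangleLTGE_distinguished n X) (i - 1)
      i (by ring))
    rw [ShortComplex.moduleCat_exact_iff] at h
    have h0 := ModuleCat.subsingleton_of_isZero
      (isZero_of_isGE ((TStructure.t.truncGE n).obj X) n (i - 1) (by omega))
    have : Module.Finite R ((homologyFunctor (ModuleCat.{u} R) i).obj ((𝟭 _).obj X)) := hX i
    refine Module.Finite.of_injective ((homologyFunctor (ModuleCat.{u} R) i).map
      ((TStructure.t.truncLTι n).app X)).hom ((injective_iff_map_eq_zero _).2 fun x hx => ?_)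
    obtain ⟨y, rfl⟩ := h x hx
    exact (congrArg _ (h0.elim y 0)).trans (map_zero _)

variable {𝔞 : Ideal R} {RΓ : DerivedCategory (ModuleCat.{u} R) ⥤ DerivedCategory (ModuleCat.{u} R)}
  [RΓ.CommShift ℤ]

/-- The five-term part of the long exact sequence of a triangle around the cohomology in degree `j`
of its middle term. -/
theorem cofinite_homology_obj₂ [RΓ.IsTriangulated]
    [Limits.HasEqualizers (cofinite 𝔞).FullSubcategory]
    (T : Triangle (DerivedCategory (ModuleCat.{u} R))) (hT : T ∈ distTriang _) (i j k : ℤ)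
    (hij : i + 1 = j) (hjk : j + 1 = k)
    (h₁ : cofinite 𝔞 ((homologyFunctor (ModuleCat.{u} R) i).obj (RΓ.obj T.obj₃)))
    (h₂ : cofinite 𝔞 ((homologyFunctor (ModuleCat.{u} R) j).obj (RΓ.obj T.obj₁)))
    (h₃ : cofinite 𝔞 ((homologyFunctor (ModuleCat.{u} R) j).obj (RΓ.obj T.obj₃)))
    (h₄ : cofinite 𝔞 ((homologyFunctor (ModuleCat.{u} R) k).obj (RΓ.obj T.obj₁))) :
    cofinite 𝔞 ((homologyFunctor (ModuleCat.{u} R) j).obj (RΓ.obj T.obj₂)) := by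
  have hT' := RΓ.map_distinguished T hT
  exact cofinite_of_exact
    ((ShortComplex.ShortExact.moduleCat_exact_iff_function_exact _).1
      (HomologySequence.exact₁ _ hT' i j hij))
    ((ShortComplex.ShortExact.moduleCat_exact_iff_function_exact _).1
      (HomologySequence.exact₂ _ hT' j))
    ((ShortComplex.ShortExact.moduleCat_exact_iff_function_exact _).1
      (HomologySequence.exact₃ _ hT' j k hjk)) h₁ h₂ h₃ h₄

/-- In degrees `i < n` the cohomology vanishes; in the other degrees this is the hypothesis on `M`
in degree `i - n`. -/
theorem cofinite_homology_single
    (hge : ∀ (X : DerivedCategory (ModuleCat.{u} R)) (n : ℤ) [X.IsGE n], (RΓ.obj X).IsGE n)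
    (hM : ∀ M : ModuleCat.{u} R, Module.Finite R M → ∀ i : ℕ,
      cofinite 𝔞 (localCohomologyModule RΓ i ((singleFunctor (ModuleCat.{u} R) 0).obj M)))
    (M : ModuleCat.{u} R) [Module.Finite R M] (n i : ℤ) :
    cofinite 𝔞 ((homologyFunctor (ModuleCat.{u} R) i).obj
      (RΓ.obj ((singleFunctor (ModuleCat.{u} R) n).obj M))) := by
  by_cases hi : i < n
  · have := ModuleCat.subsingleton_of_isZero
      (isZero_of_isGE (hX := hge _ n) (RΓ.obj ((singleFunctor (ModuleCat.{u} R) n).obj M)) n i hi)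
    exact cofinite_of_subsingleton _
  · have h1 := hM M inferInstance (i - n).toNat
    rw [localCohomologyModule, homologyModule, neg_neg, Int.toNat_of_nonneg (by omega)] at h1
    refine cofinite_of_iso ?_ h1
    exact (homologyFunctor (ModuleCat.{u} R) (i - n)).mapIso
        (RΓ.mapIso (((singleFunctors (ModuleCat.{u} R)).shiftIso n 0 n (by ring)).app M).symm ≪≫
          (RΓ.commShiftIso n).app _) ≪≫
      ((homologyFunctor (ModuleCat.{u} R) 0).shiftIso n (i - n) i (by ring)).app _

/-- Induction on the length of the interval containing the homology of `X`: split off the lowest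
degree by a truncation triangle. -/
theorem cofinite_homology_of_bounded [RΓ.IsTriangulated]
    [Limits.HasEqualizers (cofinite 𝔞).FullSubcategory]
    (hge : ∀ (X : DerivedCategory (ModuleCat.{u} R)) (n : ℤ) [X.IsGE n], (RΓ.obj X).IsGE n)
    (hM : ∀ M : ModuleCat.{u} R, Module.Finite R M → ∀ i : ℕ,
      cofinite 𝔞 (localCohomologyModule RΓ i ((singleFunctor (ModuleCat.{u} R) 0).obj M)))
    (k : ℕ) (X : DerivedCategory (ModuleCat.{u} R)) (a : ℤ) [X.IsGE a] [X.IsLE (a + k)]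
    (hX : ∀ i, Module.Finite R ((homologyFunctor (ModuleCat.{u} R) i).obj X)) (i : ℤ) :
    cofinite 𝔞 ((homologyFunctor (ModuleCat.{u} R) i).obj (RΓ.obj X)) := by
  induction k generalizing X a i with
  | zero =>
    have : X.IsLE a := TStructure.t.isLE_of_le _ (a + (0 : ℕ)) _ (by simp)
    obtain ⟨M, ⟨e⟩⟩ := X.exists_iso_singleFunctor_obj_of_isGE_of_isLE a
    have := hX a
    have : Module.Finite R M := Module.Finite.equiv
      ((homologyFunctor (ModuleCat.{u} R) a).mapIso e ≪≫
        (singleFunctorCompHomologyFunctorIso (ModuleCat.{u} R) a).app M).toLinearEquiv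
    exact cofinite_of_iso ((homologyFunctor (ModuleCat.{u} R) i).mapIso (RΓ.mapIso e.symm))
      (cofinite_homology_single hge hM M a i)
  | succ k ih =>
    have h₁ : ∀ i, cofinite 𝔞 ((homologyFunctor (ModuleCat.{u} R) i).obj
        (RΓ.obj ((TStructure.t.truncLT (a + 1)).obj X))) := fun i =>
      have : ((TStructure.t.truncLT (a + 1)).obj X).IsLE (a + k) :=
        TStructure.t.isLE_truncLT_obj X (a + 1) (a + k)
      ih _ a (finite_truncLT_homology X hX _) i
    have h₃ : ∀ i, cofinite 𝔞 ((homologyFunctor (ModuleCat.{u} R) i).obj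
        (RΓ.obj ((TStructure.t.truncGE (a + 1)).obj X))) := fun i =>
      have : X.IsLE (a + 1 + k) :=
        TStructure.t.isLE_of_le X (a + (k + 1 : ℕ)) _ (by push_cast; omega)
      ih _ (a + 1) (finite_truncGE_homology X hX _) i
    exact cofinite_homology_obj₂ _ (TStructure.t.triangleLTGE_distinguished (a + 1) X) (i - 1) i
      (i + 1) (by ring) rfl (h₃ _) (h₁ _) (h₃ _) (h₁ _)

/-- The part of `X` in degrees `> i` does not contribute to `H^i` of `RΓ X`. -/
theorem cofinite_homology_of_isGE [RΓ.IsTriangulated]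
    [Limits.HasEqualizers (cofinite 𝔞).FullSubcategory]
    (hge : ∀ (X : DerivedCategory (ModuleCat.{u} R)) (n : ℤ) [X.IsGE n], (RΓ.obj X).IsGE n)
    (hM : ∀ M : ModuleCat.{u} R, Module.Finite R M → ∀ i : ℕ,
      cofinite 𝔞 (localCohomologyModule RΓ i ((singleFunctor (ModuleCat.{u} R) 0).obj M)))
    (X : DerivedCategory (ModuleCat.{u} R)) (a : ℤ) [X.IsGE a]
    (hX : ∀ i, Module.Finite R ((homologyFunctor (ModuleCat.{u} R) i).obj X)) (i : ℤ) :
    cofinite 𝔞 ((homologyFunctor (ModuleCat.{u} R) i).obj (RΓ.obj X)) := by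
  have h₁ : ∀ i', cofinite 𝔞 ((homologyFunctor (ModuleCat.{u} R) i').obj
      (RΓ.obj ((TStructure.t.truncLT (i + 1)).obj X))) := fun i' =>
    have : ((TStructure.t.truncLT (i + 1)).obj X).IsLE (a + (i - a).toNat) :=
      TStructure.t.isLE_truncLT_obj X (i + 1) _
    cofinite_homology_of_bounded hge hM (i - a).toNat _ a (finite_truncLT_homology X hX _) i'
  have h₃ : ∀ i' < i + 1, cofinite 𝔞 ((homologyFunctor (ModuleCat.{u} R) i').obj
      (RΓ.obj ((TStructure.t.truncGE (i + 1)).obj X))) := fun i' hi' =>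
    have := ModuleCat.subsingleton_of_isZero (isZero_of_isGE (hX := hge _ (i + 1))
      (RΓ.obj ((TStructure.t.truncGE (i + 1)).obj X)) (i + 1) i' hi')
    cofinite_of_subsingleton _
  exact cofinite_homology_obj₂ _ (TStructure.t.triangleLTGE_distinguished (i + 1) X) (i - 1) i
    (i + 1) (by ring) rfl (h₃ _ (by omega)) (h₁ _) (h₃ _ (by omega)) (h₁ _)

/-- The part of `X` in degrees `< i - d` does not contribute to `H^i` of `RΓ X`. -/
theorem cofinite_homology [RΓ.IsTriangulated]
    [Limits.HasEqualizers (cofinite 𝔞).FullSubcategory]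
    (hge : ∀ (X : DerivedCategory (ModuleCat.{u} R)) (n : ℤ) [X.IsGE n], (RΓ.obj X).IsGE n)
    (d : ℕ)
    (hd : ∀ (X : DerivedCategory (ModuleCat.{u} R)) (n : ℤ) [X.IsLE n], (RΓ.obj X).IsLE (n + d))
    (hM : ∀ M : ModuleCat.{u} R, Module.Finite R M → ∀ i : ℕ,
      cofinite 𝔞 (localCohomologyModule RΓ i ((singleFunctor (ModuleCat.{u} R) 0).obj M)))
    (X : DerivedCategory (ModuleCat.{u} R))
    (hX : ∀ i, Module.Finite R ((homologyFunctor (ModuleCat.{u} R) i).obj X)) (i : ℤ) :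
    cofinite 𝔞 ((homologyFunctor (ModuleCat.{u} R) i).obj (RΓ.obj X)) := by
  have h₁ : ∀ i' ≥ i, cofinite 𝔞 ((homologyFunctor (ModuleCat.{u} R) i').obj
      (RΓ.obj ((TStructure.t.truncLT (i - d)).obj X))) := fun i' hi' =>
    have := hd ((TStructure.t.truncLT (i - d)).obj X) (i - d - 1)
    have := ModuleCat.subsingleton_of_isZero (isZero_of_isLE
      (RΓ.obj ((TStructure.t.truncLT (i - d)).obj X)) (i - d - 1 + d) i' (by omega))
    cofinite_of_subsingleton _
  have h₃ : ∀ i', cofinite 𝔞 ((homologyFunctor (ModuleCat.{u} R) i').obj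
      (RΓ.obj ((TStructure.t.truncGE (i - d)).obj X))) := fun i' =>
    cofinite_homology_of_isGE hge hM _ (i - d) (finite_truncGE_homology X hX _) i'
  exact cofinite_homology_obj₂ _ (TStructure.t.triangleLTGE_distinguished (i - d) X) (i - 1) i
    (i + 1) (by ring) rfl (h₃ _) (h₁ _ le_rfl) (h₃ _) (h₁ _ (by omega))

end LocalCohomology

end WayOutCofinite

open WayOutCofinite in
theorem theorem3p3 {R : Type u} [CommRing R] [IsNoetherianRing R] (𝔞 : Ideal R)
    [HasDerivedCategory.{w} (ModuleCat.{u} R)] :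
    -- the derived functor `RΓ_𝔞 : D(R) ⥤ D(R)` exists
    (∃ (RΓ : DerivedCategory (ModuleCat.{u} R) ⥤ DerivedCategory (ModuleCat.{u} R))
      (α : gammaHomotopy 𝔞 ⟶ DerivedCategory.Qh ⋙ RΓ), IsRGamma 𝔞 RΓ α) ∧
    ∀ (RΓ : DerivedCategory (ModuleCat.{u} R) ⥤ DerivedCategory (ModuleCat.{u} R))
      (α : gammaHomotopy 𝔞 ⟶ DerivedCategory.Qh ⋙ RΓ), IsRGamma 𝔞 RΓ α →
      -- it is triangulated, for the shift structure compatible with `α`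
      (∃ _ : RΓ.CommShift ℤ, NatTrans.CommShift α ℤ ∧ RΓ.IsTriangulated) ∧
      -- it is way-out
      IsWayOut RΓ ∧
      -- cofiniteness passes from finitely generated modules to complexes
      ((∀ M : ModuleCat.{u} R, Module.Finite R M → ∀ i : ℕ,
          cofinite 𝔞 (localCohomologyModule RΓ i
            ((DerivedCategory.singleFunctor (ModuleCat.{u} R) 0).obj M))) →
        Nonempty (Abelian (cofinite 𝔞).FullSubcategory) →
        ∀ X : DerivedCategory (ModuleCat.{u} R), HasFiniteHomology X →
          ∀ i : ℤ, cofinite 𝔞 (localCohomologyModule RΓ i X)) := by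
  refine ⟨exists_isRGamma 𝔞, fun RΓ α h => ⟨isTriangulated_of_isRGamma h,
    isWayOut_of_isRGamma h, fun hM hA X hX i => ?_⟩⟩
  obtain ⟨_, _, _⟩ := isTriangulated_of_isRGamma h
  have := hasEqualizers_of_abelian hA
  obtain ⟨s, hs⟩ := IsNoetherian.noetherian 𝔞
  rw [localCohomologyModule, homologyModule, neg_neg]
  refine cofinite_homology (fun X n _ => isGE_obj_of_isRGamma h X n) s.card
    (fun X n _ => isLE_obj_of_isRGamma s hs h X n) hM X (fun i => ?_) i
  have h1 := hX (-i)
  rwa [homologyModule, neg_neg] at h1
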